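/- **Setting.** There are $K\ge 1$ arms. The reward vector $R=(R_1,\dots,R_K)$ has an unknown joint law $\nu$ on $[0,b]^K$, $b>0$ (the coordinates may be dependent), $\mu_k=\mathbb E[R_k]$, and there is a unique best arm $k^*$, i.e. $\mu_k<\mu_{k^*}$ for all $k\ne k^*$. The player knows measurable pseudo-rewards $s_{\ell,k}:[0,b]\to[0,b]$ with $\mathbb E[R_\ell\mid R_k=r]\le s_{\ell,k}(r)$ for all $\ell,k$ (for almost every $r$) and $s_{k,k}(r)=r$. The player also has an anytime confidence bound $B(n,\eta)$, $n\ge1$, $\eta\in(0,1)$: for every law on $[0,b]$ with mean $\mu$ and i.i.d. samples from it with running means $\hat\mu_n$, $$\Pr\big(\exists\, n\ge 1:\ \mu\notin[\hat\mu_n-B(n,\eta),\ \hat\mu_n+B(n,\eta)]\big)\le\eta ,$$ where $B(n,\eta)$ is nonincreasing in $\eta$ and tends to $0$ as $n\to\infty$. Fix $\delta>0$. **Indices.** After $t$ rounds, let $n_k(t)$ be the number of samples of arm $k$, let $\hat\phi_{\ell,k}(t)$ be the average of $s_{\ell,k}(r)$ over the observed rewards $r$ of arm $k$, and $\hat\mu_k=\hat\phi_{k,k}$.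 Put $\tilde U_{\ell,k}(\eta)=\hat\phi_{\ell,k}+B(n_k,\eta)$, $\tilde U_\ell(\eta)=\min_k\tilde U_{\ell,k}(\eta)$, $L_k(\eta)=\hat\mu_k-B(n_k,\eta)$, $I_{\ell,k}=\hat\phi_{\ell,k}+b\sqrt{2\log t/n_k}$, $I_\ell=\min_k I_{\ell,k}$; if $n_k=0$, then $\tilde U_{\ell,k}=I_{\ell,k}=+\infty$ and $L_k=-\infty$. **The C-LUCB++ algorithm.** Initially no arm has been sampled and the set $\mathcal A$ of active arms is the set of all arms. With the indices after $t=0,1,2,\dots$ rounds, let $m_1\in\arg\max_{k\in\mathcal A} I_k$. The algorithm stops and declares $m_1$ if $|\mathcal A|=1$, or if $|\mathcal A|\ge2$ and $$L_{m_1}\!\left(\tfrac{\delta}{4K}\right)>\max_{\ell\in\mathcal A\setminus\{m_1\}}\tilde U_{\ell,\ell}\!\left(\tfrac{\delta}{4}\right).$$ Otherwise, in round $t+1$ it samples $m_1$ and $m_2\in\arg\max_{k\in\mathcal A\setminus\{m_1\}}\min\big(\tilde U_{k,k}(\delta/2),\,I_k\big)$, updates the indices, and then removes from $\mathcal A$ every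 arm $k$ with $\tilde U_k(\delta/(3K))<\max_{\ell\in\mathcal A}L_\ell(\delta/(3K))$. Ties are broken by any fixed rule depending only on $t$ and on the set of maximizers. (If $\mathcal A$ becomes empty, nothing is declared.) In each round there are two reward vectors of law $\nu$, which may depend on each other in any way (they may be equal, or independent); the rewards observed are the $m_1$-coordinate of the first and the $m_2$-coordinate of the second. The pairs of vectors of different rounds are independent. **Theorem.** With probability at least $1-\delta$, the C-LUCB++ algorithm stops after finitely many rounds and declares the best arm $k^*$. -/

import Mathlib

open MeasureTheory ProbabilityTheory Filter Topology

/-- `B` is an anytime confidence bound for `[0, b]`-valued samples: for i.i.d. samples with any law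
`ν` on `[0, b]` and any level `δ ∈ (0, 1)`, the probability that for some `n ≥ 1` the mean of `ν`
lies outside `[μ̂ₙ - B n δ, μ̂ₙ + B n δ]` is at most `δ`, where `μ̂ₙ` is the mean of the first `n`
samples. -/
def IsAnytimeConfidenceBound (b : ℝ) (B : ℕ → ℝ → ℝ) : Prop :=
  ∀ (ν : Measure ℝ) [IsProbabilityMeasure ν], (∀ᵐ r ∂ν, r ∈ Set.Icc 0 b) →
    ∀ δ ∈ Set.Ioo (0 : ℝ) 1,
      Measure.infinitePi (fun _ : ℕ => ν)
        {x : ℕ → ℝ | ∃ n : ℕ, 1 ≤ n ∧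
          (∫ r, r ∂ν) ∉ Set.Icc ((∑ i ∈ Finset.range n, x i) / n - B n δ)
            ((∑ i ∈ Finset.range n, x i) / n + B n δ)}
        ≤ ENNReal.ofReal δ

namespace CLUCBpp

/-- What the C-LUCB++ player knows: the maximal reward `b`, the confidence bound `B n δ`,
the pseudo-rewards `s ℓ k r` (of arm `ℓ` with respect to arm `k`, when arm `k` gives reward `r`),
the confidence parameter `δ`, and the tie-breaking rule `pick`, which after `t` rounds selects
an arm out of a finite set of maximizers. -/
structure Input (K : ℕ) where
  b : ℝ
  B : ℕ → ℝ → ℝ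
  s : Fin K → Fin K → ℝ → ℝ
  δ : ℝ
  pick : ℕ → Finset (Fin K) → Fin K

/-- What the player remembers: the number `n k` of samples of arm `k`, the sum `S ℓ k` of the
pseudo-rewards `s ℓ k r` over all observed rewards `r` of arm `k`, and the set of active arms. -/
structure State (K : ℕ) where
  n : Fin K → ℕ
  S : Fin K → Fin K → ℝ
  active : Finset (Fin K)

/-- No samples, and all arms are active. -/
def initialState (K : ℕ) : State K := ⟨fun _ => 0, fun _ _ => 0, Finset.univ⟩

/-- The elements of `A` at which `f` is maximal over `A`. -/
noncomputable def argmaxOn {K : ℕ} (A : Finset (Fin K)) (f : Fin K → EReal) : Finset (Fin K) :=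
  A.filter fun a => ∀ c ∈ A, f c ≤ f a

noncomputable section

variable {K : ℕ} (I : Input K) (t : ℕ) (σ : State K)

/-- Empirical pseudo-reward of arm `ℓ` with respect to arm `k`. As `s k k r = r`, for `ℓ = k` this is
the empirical mean of arm `k`. -/
def phiHat (ℓ k : Fin K) : ℝ := σ.S ℓ k / σ.n k

/-- CrossUCB index of arm `ℓ` with respect to arm `k` at level `η`; `+∞` if `k` has no sample. -/
def crossUCB (η : ℝ) (ℓ k : Fin K) : EReal :=
  if σ.n k = 0 then ⊤ else ((phiHat σ ℓ k + I.B (σ.n k) η : ℝ) : EReal)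

/-- CrossUCB index of arm `ℓ`: the minimum over all arms `k`. -/
def crossUCBmin (η : ℝ) (ℓ : Fin K) : EReal := ⨅ k : Fin K, crossUCB I σ η ℓ k

/-- Lower confidence index of arm `k` at level `η`; `-∞` if `k` has no sample. -/
def lcb (η : ℝ) (k : Fin K) : EReal :=
  if σ.n k = 0 then ⊥ else ((phiHat σ k k - I.B (σ.n k) η : ℝ) : EReal)

/-- PseudoUCB index of arm `ℓ` with respect to arm `k` after `t` rounds; `+∞` if `k` has no
sample. -/
def pseudoUCB (ℓ k : Fin K) : EReal :=
  if σ.n k = 0 then ⊤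
  else ((phiHat σ ℓ k + I.b * Real.sqrt (2 * Real.log t / σ.n k) : ℝ) : EReal)

/-- PseudoUCB index of arm `ℓ`: the minimum over all arms `k`. -/
def pseudoUCBmin (ℓ : Fin K) : EReal := ⨅ k : Fin K, pseudoUCB I t σ ℓ k

/-- The arm `m₁`: an active arm of maximal PseudoUCB index. -/
def m₁ : Fin K := I.pick t (argmaxOn σ.active (pseudoUCBmin I t σ))

/-- The arm `m₂`: maximizes `min (Ũ_{k,k}(δ/2)) I_k` over the active arms `k ≠ m₁`. -/
def m₂ : Fin K :=
  I.pick t (argmaxOn (σ.active.erase (m₁ I t σ))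
    fun k => min (crossUCB I σ (I.δ / 2) k k) (pseudoUCBmin I t σ k))

/-- The stopping criterion: one active arm is left, or the lower index of `m₁` at level `δ/(4K)`
exceeds the upper index `Ũ_{ℓ,ℓ}` at level `δ/4` of every other active arm `ℓ`. -/
def Stops : Prop :=
  σ.active.card = 1 ∨
    (1 < σ.active.card ∧ ∀ ℓ ∈ σ.active.erase (m₁ I t σ),
      crossUCB I σ (I.δ / 4) ℓ ℓ < lcb I σ (I.δ / (4 * K)) (m₁ I t σ))

/-- Record the rewards `x m₁` of arm `m₁` and `y m₂` of arm `m₂`. -/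
def sample (x y : Fin K → ℝ) : State K where
  n k := σ.n k + (if k = m₁ I t σ then 1 else 0) + (if k = m₂ I t σ then 1 else 0)
  S ℓ k := σ.S ℓ k + (if k = m₁ I t σ then I.s ℓ k (x k) else 0)
    + (if k = m₂ I t σ then I.s ℓ k (y k) else 0)
  active := σ.active

open Classical in
/-- Remove every active arm `k` with `Ũ_k(δ/(3K)) < max_{ℓ active} L_ℓ(δ/(3K))`. -/
def eliminate : State K where
  n := σ.n
  S := σ.S
  active := σ.active.filter fun k =>
    ¬ crossUCBmin I σ (I.δ / (3 * K)) k < σ.active.sup (lcb I σ (I.δ / (3 * K)))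

/-- The state after `t` rounds when `x t` and `y t` are the reward vectors of round `t + 1`, out of
which the rewards of `m₁` and `m₂`, respectively, are observed. (After the stopping round the
recursion goes on formally; see `Declares`.) -/
def run (x y : ℕ → Fin K → ℝ) : ℕ → State K
  | 0 => initialState K
  | t + 1 => eliminate I (sample I t (run x y t) (x t) (y t))

/-- The algorithm stops, and declares arm `k`: at the first time `T` at which the stopping criterion
holds, `m₁ = k` (this is the only active arm in case just one is left). -/
def Declares (x y : ℕ → Fin K → ℝ) (k : Fin K) : Prop :=
  ∃ T : ℕ, Stops I T (run I x y T) ∧ (∀ t < T, ¬ Stops I t (run I x y t)) ∧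
    m₁ I T (run I x y T) = k

end

end CLUCBpp

/-! The proof has a probabilistic and a deterministic half. Outside an event of probability at most
δ/3 + δ/3 + δ/4, all φ̂_{k*,k} and μ̂_k obey their bounds at level δ/(3K), and μ̂_{k*} also at level
δ/4, as long as two arms have been active. Sampling is adaptive, so the i.i.d. bound is transferred
by optional skipping: the conditional probability that the samples seen so far, continued by fresh
ones, break the bound is a martingale (`measure_exists_forall_splice_mem_le`,
`measure_phiHat_deviation_le`).

The rest is pathwise (`declares_of_accurate`). The mean of s_{k*,k} is at least μ_{k*}, so the upper
indices of k* stay above μ_{k*} and the lower indices below it: k* is never eliminated and no other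
arm is declared. If the algorithm never stopped, two distinct arms would be sampled in every round.
In late rounds a suboptimal arm can be m₁ only while it has O(log t) samples, since its PseudoUCB
index must reach that of k*; hence k* is sampled without bound (`n_kstar_unbounded`). Then a
suboptimal arm with enough samples is eliminated (`n_bounded_of_ne`), although every round samples
some suboptimal arm (`le_sum_n_of_ne`), a contradiction. About m₂ this uses only that it is active
and differs from m₁. -/

/-! ### Optional skipping for predictable selections. -/

section OptionalSkipping

variable {Ω α : Type*}

/-- The sequence that starts with the first `h.1` terms of `h.2` and goes on as `z`. -/
def splice (h : ℕ × (ℕ → α)) (z : ℕ → α) : ℕ → α := fun i => if i < h.1 then h.2 i else z i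

/-- Append the term `v` to the finite sequence of the first `h.1` terms of `h.2`. -/
def appendTerm (h : ℕ × (ℕ → α)) (v : α) : ℕ × (ℕ → α) :=
  (h.1 + 1, fun i => if i = h.1 then v else h.2 i)

open Classical in
/-- The finite sequence of those among `V 0, …, V (t - 1)` that are selected by `D`. -/
noncomputable def selected [Inhabited α] (D : ℕ → Set Ω) (V : ℕ → Ω → α) (ω : Ω) :
    ℕ → ℕ × (ℕ → α)
  | 0 => (0, fun _ => default)
  | t + 1 => if ω ∈ D t then appendTerm (selected D V ω t) (V t ω) else selected D V ω t

lemma splice_appendTerm (h : ℕ × (ℕ → α)) (v : α) (z : ℕ → α) :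
    splice (appendTerm h v) z = splice h (fun i => if i = h.1 then v else z i) := by
  funext i
  simp only [splice, appendTerm]
  grind

variable [MeasurableSpace α]

lemma measurable_splice :
    Measurable fun p : (ℕ × (ℕ → α)) × (ℕ → α) => splice p.1 p.2 := by
  refine measurable_pi_iff.2 fun i => ?_
  unfold splice
  exact Measurable.ite (measurableSet_lt measurable_const (by fun_prop)) (by fun_prop)
    (by fun_prop)

lemma measurable_appendTerm :
    Measurable fun p : (ℕ × (ℕ → α)) × α => appendTerm p.1 p.2 := by
  refine Measurable.prodMk (by fun_prop) (measurable_pi_iff.2 fun i => ?_)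
  exact Measurable.ite (measurableSet_eq_fun measurable_const (by fun_prop)) (by fun_prop)
    (by fun_prop)

/-- Finite boxes determine the product law, and the preimage of a box splits off its `n`-th side. -/
lemma map_replace_infinitePi (ρ : Measure α) [IsProbabilityMeasure ρ] (n : ℕ) :
    (ρ.prod (Measure.infinitePi fun _ : ℕ => ρ)).map
      (fun p i => if i = n then p.1 else p.2 i) = Measure.infinitePi fun _ : ℕ => ρ := by
  have hm : Measurable fun (p : α × (ℕ → α)) (i : ℕ) => if i = n then p.1 else p.2 i := by
    refine measurable_pi_iff.2 fun i => ?_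
    split_ifs <;> fun_prop
  refine Measure.eq_infinitePi _ fun s t ht => ?_
  rw [Measure.map_apply hm (MeasurableSet.pi s.countable_toSet fun i _ => ht i)]
  have : (fun (p : α × (ℕ → α)) (i : ℕ) => if i = n then p.1 else p.2 i) ⁻¹' (Set.pi s t)
      = (if n ∈ s then t n else Set.univ) ×ˢ (Set.pi (s.erase n) t) := by
    ext ⟨r, z⟩
    simp only [Set.mem_preimage, Set.mem_pi, Finset.mem_coe, Set.mem_prod, Finset.mem_erase]
    constructor
    · intro h
      refine ⟨?_, fun i hi => by simpa [hi.1] using h i hi.2⟩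
      split_ifs with hn
      · simpa using h n hn
      · trivial
    · rintro ⟨h1, h2⟩ i hi
      by_cases hin : i = n
      · subst hin
        simpa [hi] using h1
      · simpa [hin] using h2 i ⟨hin, hi⟩
  rw [this, Measure.prod_prod, Measure.infinitePi_pi _ fun i _ => ht i]
  split_ifs with hn
  · exact Finset.mul_prod_erase s (fun i => ρ (t i)) hn
  · rw [measure_univ, one_mul, Finset.erase_eq_of_notMem hn]

/-- The probability that the finite sequence `h`, continued by independent terms of law `ρ`, lies
in `E`. -/
noncomputable def continuationProb (ρ : Measure α) (E : Set (ℕ → α)) (h : ℕ × (ℕ → α)) : ENNReal :=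
  Measure.infinitePi (fun _ : ℕ => ρ) {z | splice h z ∈ E}

variable {ρ : Measure α} [IsProbabilityMeasure ρ] {E : Set (ℕ → α)}

lemma measurable_continuationProb (hE : MeasurableSet E) :
    Measurable (continuationProb ρ E) :=
  measurable_measure_prodMk_left (measurable_splice hE)

/-- Appending a fresh term merely redraws coordinate `h.1` of the continuation, which leaves the
product law unchanged. This is the one-step martingale identity. -/
lemma lintegral_continuationProb_appendTerm (hE : MeasurableSet E) (h : ℕ × (ℕ → α)) :
    ∫⁻ v, continuationProb ρ E (appendTerm h v) ∂ρ = continuationProb ρ E h := by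
  have hm : Measurable fun (p : α × (ℕ → α)) (i : ℕ) => if i = h.1 then p.1 else p.2 i := by
    refine measurable_pi_iff.2 fun i => ?_
    split_ifs <;> fun_prop
  have hS : MeasurableSet {z | splice h z ∈ E} :=
    (measurable_splice.comp measurable_prodMk_left) hE
  conv_rhs => rw [continuationProb, ← map_replace_infinitePi ρ h.1, Measure.map_apply hm hS,
    Measure.prod_apply (hm hS)]
  simp only [continuationProb, splice_appendTerm]
  rfl

variable [MeasurableSpace Ω] [Inhabited α] {P : Measure Ω} [IsProbabilityMeasure P]
  {ℱ : Filtration ℕ ‹MeasurableSpace Ω›} {D : ℕ → Set Ω} {V : ℕ → Ω → α}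

lemma measurable_selected (hV : ∀ t, Measurable[ℱ (t + 1)] (V t))
    (hD : ∀ t, MeasurableSet[ℱ t] (D t)) (t : ℕ) :
    Measurable[ℱ t] fun ω => selected D V ω t := by
  induction t with
  | zero => exact measurable_const
  | succ t ih =>
    have h1 : Measurable[ℱ (t + 1)] fun ω => selected D V ω t := ih.mono (ℱ.mono t.le_succ) le_rfl
    exact Measurable.ite (ℱ.mono t.le_succ _ (hD t))
      (measurable_appendTerm.comp (Measurable.prodMk h1 (hV t))) h1

/-- Given the past, a round either changes nothing or appends an independent term of law `ρ`, so the
expectation keeps its initial value. -/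
lemma lintegral_continuationProb_selected (hE : MeasurableSet E)
    (hV : ∀ t, Measurable[ℱ (t + 1)] (V t)) (hD : ∀ t, MeasurableSet[ℱ t] (D t))
    (hind : ∀ t, Indep (ℱ t) (MeasurableSpace.comap (V t) inferInstance) P)
    (hlaw : ∀ t, P.map (V t) = ρ) (t : ℕ) :
    ∫⁻ ω, continuationProb ρ E (selected D V ω t) ∂P = Measure.infinitePi (fun _ => ρ) E := by
  classical
  induction t with
  | zero =>
    have hz : ∀ z : ℕ → α, splice (0, fun _ => default) z = z := fun z => by
      funext i
      simp [splice]
    simp [selected, continuationProb, hz]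
  | succ t ih =>
    rw [← ih]
    have hVm : Measurable (V t) := (hV t).mono (ℱ.le _) le_rfl
    -- `Q` collects the decision and the terms selected so far; both belong to the past and are thus
    -- independent of `V t`.
    let Q : Ω → Prop × (ℕ × (ℕ → α)) := fun ω => (ω ∈ D t, selected D V ω t)
    have hDt : Measurable[ℱ t] fun ω => ω ∈ D t := @MeasurableSet.mem _ _ (ℱ t) (hD t)
    have hQ' : Measurable[ℱ t] Q :=
      Measurable.prodMk hDt (measurable_selected hV hD t)
    have hQ : Measurable Q := hQ'.mono (ℱ.le _) le_rfl
    let g : (Prop × (ℕ × (ℕ → α))) × α → ENNReal := fun p =>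
      continuationProb ρ E (if p.1.1 then appendTerm p.1.2 p.2 else p.1.2)
    have hg : Measurable g := by
      refine (measurable_continuationProb hE).comp (Measurable.ite ?_ ?_ (by fun_prop))
      · exact measurableSet_setOfPred.2 (measurable_fst.comp measurable_fst)
      · exact measurable_appendTerm.comp ((measurable_snd.comp measurable_fst).prodMk measurable_snd)
    have hindep : IndepFun Q (V t) P :=
      (IndepFun_iff_Indep _ _ _).2 (indep_of_indep_of_le_left (hind t) hQ'.comap_le)
    have hprod := (indepFun_iff_map_prod_eq_prod_map_map hQ.aemeasurable hVm.aemeasurable).1 hindep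
    calc ∫⁻ ω, continuationProb ρ E (selected D V ω (t + 1)) ∂P
        = ∫⁻ ω, g (Q ω, V t ω) ∂P := rfl
      _ = ∫⁻ q, ∫⁻ v, g (q, v) ∂ρ ∂(P.map Q) := by
          rw [← lintegral_map hg (hQ.prodMk hVm), hprod, hlaw, lintegral_prod _ hg.aemeasurable]
      _ = ∫⁻ q, continuationProb ρ E q.2 ∂(P.map Q) := by
          refine lintegral_congr fun q => ?_
          by_cases hq : q.1
          · simp only [g, hq, if_true]
            exact lintegral_continuationProb_appendTerm hE q.2
          · simp [g, hq]
      _ = ∫⁻ ω, continuationProb ρ E (selected D V ω t) ∂P :=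
          lintegral_map ((measurable_continuationProb hE).comp measurable_snd) hQ

/-- Optional skipping: if terms are selected without looking ahead, the probability that the
selected ones ever force a sequence into `E` is at most the probability of `E` for independent
terms. -/
theorem measure_exists_forall_splice_mem_le (hE : MeasurableSet E)
    (hV : ∀ t, Measurable[ℱ (t + 1)] (V t)) (hD : ∀ t, MeasurableSet[ℱ t] (D t))
    (hind : ∀ t, Indep (ℱ t) (MeasurableSpace.comap (V t) inferInstance) P)
    (hlaw : ∀ t, P.map (V t) = ρ) :
    P {ω | ∃ t, ∀ z, splice (selected D V ω t) z ∈ E} ≤ Measure.infinitePi (fun _ => ρ) E := by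
  -- A forced sequence stays forced, because a further term only restricts the possible
  -- continuations.
  have hmono : Monotone fun t => {ω | ∀ z, splice (selected D V ω t) z ∈ E} := by
    refine monotone_nat_of_le_succ fun t ω hω z => ?_
    rw [selected]
    split_ifs
    · rw [splice_appendTerm]
      exact hω _
    · exact hω z
  rw [Set.ofPred_exists, hmono.measure_iUnion]
  refine iSup_le fun t => ?_
  rw [← lintegral_continuationProb_selected hE hV hD hind hlaw t]
  -- Markov's inequality at threshold 1: where `E` is forced, the continuation probability is 1.
  refine le_trans (measure_mono fun ω hω => ?_)
    ((one_mul _).symm.le.trans (mul_meas_ge_le_lintegral ((measurable_continuationProb hE).comp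
      ((measurable_selected hV hD t).mono (ℱ.le _) le_rfl)) 1))
  have : {z | splice (selected D V ω t) z ∈ E} = Set.univ := Set.eq_univ_of_forall hω
  simp [continuationProb, this]

end OptionalSkipping

/-- The past decides which copy is read, so each past event is split along `A`. Needed because an
arm's reward comes from `X` or `Y` according to its role; `U` and `W` may depend on each other. -/
lemma indep_ite_of_indep {Ω α : Type*} [MeasurableSpace α] {m mΩ : MeasurableSpace Ω}
    {P : Measure Ω} [IsProbabilityMeasure P] {ρ : Measure α} {U W : Ω → α} {A : Set Ω}
    [DecidablePred (· ∈ A)] (hm : m ≤ mΩ) (hU : Measurable U) (hW : Measurable W)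
    (hUi : Indep m (MeasurableSpace.comap U inferInstance) P)
    (hWi : Indep m (MeasurableSpace.comap W inferInstance) P)
    (hUρ : P.map U = ρ) (hWρ : P.map W = ρ) (hA : MeasurableSet[m] A) :
    Indep m (MeasurableSpace.comap (fun ω => if ω ∈ A then U ω else W ω) inferInstance) P ∧
      P.map (fun ω => if ω ∈ A then U ω else W ω) = ρ := by
  have hV : Measurable fun ω => if ω ∈ A then U ω else W ω := Measurable.ite (hm _ hA) hU hW
  have key : ∀ C, MeasurableSet[m] C → ∀ F, MeasurableSet F →
      P (C ∩ (fun ω => if ω ∈ A then U ω else W ω) ⁻¹' F) = P C * ρ F := by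
    intro C hC F hF
    have hUF := (Indep_iff _ _ _).1 hUi (C ∩ A) _ (hC.inter hA) ⟨F, hF, rfl⟩
    have hWF := (Indep_iff _ _ _).1 hWi (C \ A) _ (hC.diff hA) ⟨F, hF, rfl⟩
    rw [← Measure.map_apply hU hF, hUρ] at hUF
    rw [← Measure.map_apply hW hF, hWρ] at hWF
    rw [← measure_inter_add_sdiff _ (hm _ hA), ← measure_inter_add_sdiff C (hm _ hA), add_mul,
      ← hUF, ← hWF]
    congr 2
    · ext ω
      by_cases h : ω ∈ A <;> simp [h]
    · ext ω
      by_cases h : ω ∈ A <;> simp [h]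
  have hlaw : P.map (fun ω => if ω ∈ A then U ω else W ω) = ρ := by
    ext F hF
    rw [Measure.map_apply hV hF]
    simpa using key Set.univ MeasurableSet.univ F hF
  refine ⟨(Indep_iff _ _ _).2 ?_, hlaw⟩
  rintro C _ hC ⟨F, hF, rfl⟩
  rw [key C hC F hF, ← Measure.map_apply hV hF, hlaw]

/-- An anytime confidence bound holds for the running means of any terms that are selected without
looking ahead. -/
theorem IsAnytimeConfidenceBound.measure_selected_le {Ω : Type*} [MeasurableSpace Ω]
    {P : Measure Ω} [IsProbabilityMeasure P] {ℱ : Filtration ℕ ‹MeasurableSpace Ω›}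
    {D : ℕ → Set Ω} {V : ℕ → Ω → ℝ} {ρ : Measure ℝ} [IsProbabilityMeasure ρ] {b : ℝ}
    {B : ℕ → ℝ → ℝ} (hB : IsAnytimeConfidenceBound b B) (hρ : ∀ᵐ r ∂ρ, r ∈ Set.Icc 0 b)
    (hV : ∀ t, Measurable[ℱ (t + 1)] (V t)) (hD : ∀ t, MeasurableSet[ℱ t] (D t))
    (hind : ∀ t, Indep (ℱ t) (MeasurableSpace.comap (V t) inferInstance) P)
    (hlaw : ∀ t, P.map (V t) = ρ) {η : ℝ} (hη : η ∈ Set.Ioo (0 : ℝ) 1) :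
    P {ω | ∃ t, 1 ≤ (selected D V ω t).1 ∧
      B (selected D V ω t).1 η < |(∑ i ∈ Finset.range (selected D V ω t).1,
        (selected D V ω t).2 i) / (selected D V ω t).1 - ∫ r, r ∂ρ|} ≤ ENNReal.ofReal η := by
  let E : Set (ℕ → ℝ) := {x : ℕ → ℝ | ∃ n : ℕ, 1 ≤ n ∧
    (∫ r, r ∂ρ) ∉ Set.Icc ((∑ i ∈ Finset.range n, x i) / n - B n η)
      ((∑ i ∈ Finset.range n, x i) / n + B n η)}
  have hE : MeasurableSet E := by
    simp only [E, Set.ofPred_exists, Set.mem_Icc]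
    refine MeasurableSet.iUnion fun n => (MeasurableSet.const _).inter (MeasurableSet.compl ?_)
    have hm : Measurable fun x : ℕ → ℝ => (∑ i ∈ Finset.range n, x i) / n := by fun_prop
    exact (measurableSet_le (hm.sub_const _) measurable_const).inter
      (measurableSet_le measurable_const (hm.add_const _))
  refine le_trans (measure_mono ?_)
    ((measure_exists_forall_splice_mem_le hE hV hD hind hlaw).trans (hB ρ hρ η hη))
  rintro ω ⟨t, h1, h2⟩
  -- A violation at time n depends on the first n terms only, so every continuation shows it.
  refine ⟨t, fun z => ⟨_, h1, ?_⟩⟩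
  have hsum : ∑ i ∈ Finset.range (selected D V ω t).1, splice (selected D V ω t) z i
      = ∑ i ∈ Finset.range (selected D V ω t).1, (selected D V ω t).2 i :=
    Finset.sum_congr rfl fun i hi => if_pos (Finset.mem_range.1 hi)
  rw [hsum]
  intro h
  refine h2.not_ge (abs_le.2 ⟨?_, ?_⟩) <;> linarith [h.1, h.2]

/-! ### Choices of the algorithm and their measurability. -/

namespace CLUCBpp

variable {K : ℕ}

lemma argmaxOn_nonempty {A : Finset (Fin K)} (hA : A.Nonempty) (f : Fin K → EReal) :
    (argmaxOn A f).Nonempty := by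
  obtain ⟨a, ha, hmax⟩ := A.exists_max_image f hA
  exact ⟨a, Finset.mem_filter.2 ⟨ha, hmax⟩⟩

lemma mem_of_mem_argmaxOn {A : Finset (Fin K)} {f : Fin K → EReal} {a : Fin K}
    (ha : a ∈ argmaxOn A f) : a ∈ A :=
  (Finset.mem_filter.1 ha).1

section Choice

variable {I : Input K} {t : ℕ} {σ : State K}

lemma m₁_mem_argmaxOn (hpick : ∀ t S, S.Nonempty → I.pick t S ∈ S) (hσ : σ.active.Nonempty) :
    m₁ I t σ ∈ argmaxOn σ.active (pseudoUCBmin I t σ) :=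
  hpick _ _ (argmaxOn_nonempty hσ _)

lemma m₁_mem_active (hpick : ∀ t S, S.Nonempty → I.pick t S ∈ S) (hσ : σ.active.Nonempty) :
    m₁ I t σ ∈ σ.active :=
  mem_of_mem_argmaxOn (m₁_mem_argmaxOn hpick hσ)

lemma m₂_mem_erase (hpick : ∀ t S, S.Nonempty → I.pick t S ∈ S) (hσ : 1 < σ.active.card) :
    m₂ I t σ ∈ σ.active.erase (m₁ I t σ) := by
  have hne : (σ.active.erase (m₁ I t σ)).Nonempty := by
    rw [← Finset.card_pos,
      Finset.card_erase_of_mem (m₁_mem_active hpick (Finset.card_pos.1 (by omega)))]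
    omega
  exact mem_of_mem_argmaxOn (hpick _ _ (argmaxOn_nonempty hne _))

end Choice

section Measurability

variable {Ω : Type*} [MeasurableSpace Ω]

/-- A random state of the player depends measurably on chance. -/
structure MeasurableState (σ : Ω → State K) : Prop where
  n : ∀ k, Measurable fun ω => (σ ω).n k
  S : ∀ ℓ k, Measurable fun ω => (σ ω).S ℓ k
  active : ∀ k, Measurable fun ω => k ∈ (σ ω).active

/-- There are finitely many values of `F ω`, so no condition on `p` is needed; this covers arbitrary
tie-breaking. -/
lemma measurable_finset_pred {F : Ω → Finset (Fin K)} (hF : ∀ a, Measurable fun ω => a ∈ F ω)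
    (p : Finset (Fin K) → Prop) : Measurable fun ω => p (F ω) := by
  have : (fun ω => p (F ω)) = fun ω => ∃ S, p S ∧ ∀ a, a ∈ F ω ↔ a ∈ S := by
    funext ω
    refine propext ⟨fun h => ⟨F ω, h, fun _ => Iff.rfl⟩, ?_⟩
    rintro ⟨S, hS, h⟩
    rwa [Finset.ext h]
  rw [this]
  exact Measurable.exists fun S => measurable_const.and
    (Measurable.forall fun a => (hF a).iff measurable_const)

lemma measurable_mem_argmaxOn {A : Ω → Finset (Fin K)} {f : Ω → Fin K → EReal}
    (hA : ∀ a, Measurable fun ω => a ∈ A ω) (hf : ∀ a, Measurable fun ω => f ω a) (a : Fin K) :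
    Measurable fun ω => a ∈ argmaxOn (A ω) (f ω) := by
  simp only [argmaxOn, Finset.mem_filter]
  exact (hA a).and (Measurable.forall fun c =>
    (hA c).imp (measurableSet_le (hf c) (hf a)).mem)

variable {σ : Ω → State K} (I : Input K) (t : ℕ)

namespace MeasurableState

lemma phiHat (hσ : MeasurableState σ) (ℓ k : Fin K) :
    Measurable fun ω => phiHat (σ ω) ℓ k :=
  (hσ.S ℓ k).div ((measurable_from_top (f := fun n : ℕ => (n : ℝ))).comp (hσ.n k))

lemma measurable_comp_n {β : Type*} [MeasurableSpace β] (hσ : MeasurableState σ) (k : Fin K)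
    (f : ℕ → β) : Measurable fun ω => f ((σ ω).n k) :=
  measurable_from_top.comp (hσ.n k)

lemma crossUCB (hσ : MeasurableState σ) (η : ℝ) (ℓ k : Fin K) :
    Measurable fun ω => crossUCB I (σ ω) η ℓ k :=
  Measurable.ite (hσ.n k (measurableSet_singleton 0)) measurable_const
    ((hσ.phiHat ℓ k).add (hσ.measurable_comp_n k fun n => I.B n η)).coe_real_ereal

lemma crossUCBmin (hσ : MeasurableState σ) (η : ℝ) (ℓ : Fin K) :
    Measurable fun ω => crossUCBmin I (σ ω) η ℓ :=
  Measurable.iInf fun k => hσ.crossUCB I η ℓ k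

lemma lcb (hσ : MeasurableState σ) (η : ℝ) (k : Fin K) :
    Measurable fun ω => lcb I (σ ω) η k :=
  Measurable.ite (hσ.n k (measurableSet_singleton 0)) measurable_const
    ((hσ.phiHat k k).sub (hσ.measurable_comp_n k fun n => I.B n η)).coe_real_ereal

lemma pseudoUCBmin (hσ : MeasurableState σ) (ℓ : Fin K) :
    Measurable fun ω => pseudoUCBmin I t (σ ω) ℓ :=
  Measurable.iInf fun k => Measurable.ite (hσ.n k (measurableSet_singleton 0)) measurable_const
    ((hσ.phiHat ℓ k).add (hσ.measurable_comp_n k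
      fun n => I.b * Real.sqrt (2 * Real.log t / n))).coe_real_ereal

lemma m₁_eq (hσ : MeasurableState σ) (j : Fin K) : Measurable fun ω => j = m₁ I t (σ ω) :=
  measurable_finset_pred (measurable_mem_argmaxOn hσ.active (hσ.pseudoUCBmin I t))
    fun S => j = I.pick t S

lemma m₂_eq (hσ : MeasurableState σ) (j : Fin K) : Measurable fun ω => j = m₂ I t (σ ω) := by
  refine measurable_finset_pred (measurable_mem_argmaxOn (fun a => ?_) fun a => ?_)
    fun S => j = I.pick t S
  · simp only [Finset.mem_erase]
    exact (hσ.m₁_eq I t a).not.and (hσ.active a)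
  · exact (hσ.crossUCB I _ a a).min (hσ.pseudoUCBmin I t a)

lemma one_lt_card (hσ : MeasurableState σ) : Measurable fun ω => 1 < (σ ω).active.card :=
  measurable_finset_pred hσ.active fun S => 1 < S.card

lemma sample (hσ : MeasurableState σ) (hs : ∀ ℓ k, Measurable (I.s ℓ k)) {x y : Ω → Fin K → ℝ}
    (hx : Measurable x) (hy : Measurable y) :
    MeasurableState fun ω => sample I t (σ ω) (x ω) (y ω) where
  n k := ((hσ.n k).add (Measurable.ite (hσ.m₁_eq I t k).setOf measurable_const
    measurable_const)).add (Measurable.ite (hσ.m₂_eq I t k).setOf measurable_const measurable_const)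
  S ℓ k := ((hσ.S ℓ k).add (Measurable.ite (hσ.m₁_eq I t k).setOf
    ((hs ℓ k).comp ((measurable_pi_apply k).comp hx)) measurable_const)).add
    (Measurable.ite (hσ.m₂_eq I t k).setOf
    ((hs ℓ k).comp ((measurable_pi_apply k).comp hy)) measurable_const)
  active := hσ.active

lemma eliminate (hσ : MeasurableState σ) : MeasurableState fun ω => eliminate I (σ ω) where
  n := hσ.n
  S := hσ.S
  active k := by
    simp only [CLUCBpp.eliminate, Finset.mem_filter, Finset.lt_sup_iff]
    exact (hσ.active k).and (Measurable.exists fun ℓ => (hσ.active ℓ).and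
      (measurableSet_lt (hσ.crossUCBmin I _ k) (hσ.lcb I _ ℓ)).mem).not

end MeasurableState

end Measurability

lemma MeasurableState.mono {Ω : Type*} {m m' : MeasurableSpace Ω} {σ : Ω → State K}
    (hσ : @MeasurableState K Ω m σ) (hle : m ≤ m') : @MeasurableState K Ω m' σ :=
  @MeasurableState.mk K Ω m' σ
    (fun k => (@MeasurableState.n K Ω m σ hσ k).mono hle le_rfl)
    (fun ℓ k => (@MeasurableState.S K Ω m σ hσ ℓ k).mono hle le_rfl)
    fun k => (@MeasurableState.active K Ω m σ hσ k).mono hle le_rfl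

lemma measurableState_run {Ω : Type*} {m : MeasurableSpace Ω} {ℱ : Filtration ℕ m}
    {X Y : ℕ → Ω → Fin K → ℝ} (I : Input K) (hs : ∀ ℓ k, Measurable (I.s ℓ k))
    (hX : ∀ t, Measurable[ℱ (t + 1)] (X t)) (hY : ∀ t, Measurable[ℱ (t + 1)] (Y t)) (t : ℕ) :
    @MeasurableState K Ω (ℱ t) fun ω => run I (X · ω) (Y · ω) t := by
  induction t with
  | zero =>
    exact @MeasurableState.mk K Ω (ℱ 0) _ (fun _ => measurable_const) (fun _ _ => measurable_const)
      fun _ => measurable_const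
  | succ t ih =>
    exact @MeasurableState.eliminate K Ω (ℱ (t + 1)) _ I
      (@MeasurableState.sample K Ω (ℱ (t + 1)) _ I t (ih.mono (ℱ.mono t.le_succ)) hs _ _
        (hX t) (hY t))

/-! ### Confidence bounds under adaptive sampling. -/

section Deviation

variable {Ω : Type*} (I : Input K) (X Y : ℕ → Ω → Fin K → ℝ)

/-- In round `t + 1` at least two arms are active, and arm `k` is sampled. -/
def sampledAt (k : Fin K) (t : ℕ) : Set Ω :=
  {ω | 1 < (run I (X · ω) (Y · ω) t).active.card ∧
    (k = m₁ I t (run I (X · ω) (Y · ω) t) ∨ k = m₂ I t (run I (X · ω) (Y · ω) t))}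

/-- The pseudo-reward of arm `ℓ` with respect to arm `k` seen in round `t + 1` if `k` is sampled. -/
noncomputable def pseudoReward (ℓ k : Fin K) (t : ℕ) (ω : Ω) : ℝ :=
  if ω ∈ {ω | k = m₁ I t (run I (X · ω) (Y · ω) t)} then I.s ℓ k (X t ω k) else I.s ℓ k (Y t ω k)

variable {I X Y}

/-- Two active arms ensure m₁ ≠ m₂, so a round adds at most one term per arm. Otherwise `pick` would
face an empty set and might sample m₁ twice. -/
lemma selected_pseudoReward (hpick : ∀ t S, S.Nonempty → I.pick t S ∈ S) (ℓ k : Fin K) (ω : Ω)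
    (t : ℕ) (ht : ∀ i < t, 1 < (run I (X · ω) (Y · ω) i).active.card) :
    (selected (sampledAt I X Y k) (pseudoReward I X Y ℓ k) ω t).1
        = (run I (X · ω) (Y · ω) t).n k ∧
      ∑ i ∈ Finset.range (selected (sampledAt I X Y k) (pseudoReward I X Y ℓ k) ω t).1,
        (selected (sampledAt I X Y k) (pseudoReward I X Y ℓ k) ω t).2 i
        = (run I (X · ω) (Y · ω) t).S ℓ k := by
  induction t with
  | zero => simp [selected, run, initialState]
  | succ t ih =>
    obtain ⟨ihn, ihS⟩ := ih fun i hi => ht i (by omega)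
    have hcard := ht t t.lt_succ_self
    have hne := Finset.ne_of_mem_erase (m₂_mem_erase (t := t) hpick hcard)
    have happ : ∀ v : ℝ, ∑ i ∈ Finset.range
        (appendTerm (selected (sampledAt I X Y k) (pseudoReward I X Y ℓ k) ω t) v).1,
        (appendTerm (selected (sampledAt I X Y k) (pseudoReward I X Y ℓ k) ω t) v).2 i
        = (run I (X · ω) (Y · ω) t).S ℓ k + v := by
      intro v
      simp only [appendTerm, Finset.sum_range_succ, if_true, ← ihS, add_left_inj]
      exact Finset.sum_congr rfl fun i hi => if_neg (Finset.mem_range.1 hi).ne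
    rw [selected]
    by_cases h1 : k = m₁ I t (run I (X · ω) (Y · ω) t)
    · have h2 : k ≠ m₂ I t (run I (X · ω) (Y · ω) t) := fun h => hne (h.symm.trans h1)
      rw [if_pos (show ω ∈ sampledAt I X Y k t from ⟨hcard, Or.inl h1⟩), happ]
      simp only [run, eliminate, sample, if_pos h1, if_neg h2, appendTerm, ihn, pseudoReward,
        Set.mem_ofPred_eq, add_zero, and_self]
    · by_cases h2 : k = m₂ I t (run I (X · ω) (Y · ω) t)
      · rw [if_pos (show ω ∈ sampledAt I X Y k t from ⟨hcard, Or.inr h2⟩), happ]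
        simp only [run, eliminate, sample, if_neg h1, if_pos h2, appendTerm, ihn, pseudoReward,
          Set.mem_ofPred_eq, add_zero, and_self]
      · rw [if_neg fun h : ω ∈ sampledAt I X Y k t => h.2.elim h1 h2]
        simp only [run, eliminate, sample, if_neg h1, if_neg h2, add_zero]
        exact ⟨ihn, ihS⟩

/-- Before the stopping time, the running means of the pseudo-rewards obey the anytime confidence
bound although the arms are sampled adaptively. -/
theorem measure_phiHat_deviation_le {mΩ : MeasurableSpace Ω} {P : Measure Ω}
    [IsProbabilityMeasure P] {ν : Measure (Fin K → ℝ)} [IsProbabilityMeasure ν]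
    (hbdd : ∀ᵐ r ∂ν, ∀ k, r k ∈ Set.Icc 0 I.b)
    (hs_meas : ∀ ℓ k, Measurable (I.s ℓ k))
    (hs_range : ∀ ℓ k, ∀ r ∈ Set.Icc 0 I.b, I.s ℓ k r ∈ Set.Icc 0 I.b)
    (hB : IsAnytimeConfidenceBound I.b I.B)
    (hpick : ∀ t S, S.Nonempty → I.pick t S ∈ S)
    (hX : ∀ t, Measurable (X t)) (hY : ∀ t, Measurable (Y t))
    (hXν : ∀ t, P.map (X t) = ν) (hYν : ∀ t, P.map (Y t) = ν)
    (hindep : iIndepFun (fun t ω => (X t ω, Y t ω)) P)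
    (ℓ k : Fin K) {η : ℝ} (hη : η ∈ Set.Ioo (0 : ℝ) 1) :
    P {ω | ∃ t, (∀ i < t, 1 < (run I (X · ω) (Y · ω) i).active.card) ∧
      1 ≤ (run I (X · ω) (Y · ω) t).n k ∧ I.B ((run I (X · ω) (Y · ω) t).n k) η <
        |phiHat (run I (X · ω) (Y · ω) t) ℓ k - ∫ r, I.s ℓ k (r k) ∂ν|} ≤ ENNReal.ofReal η := by
  let ξ : ℕ → MeasurableSpace Ω := fun t =>
    MeasurableSpace.comap (fun ω => (X t ω, Y t ω)) inferInstance
  have hξ : ∀ t, ξ t ≤ mΩ := fun t => ((hX t).prodMk (hY t)).comap_le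
  -- `ℱ t` contains the rounds with index below `t`, hence is independent of the whole pair used
  -- next.
  let ℱ : Filtration ℕ mΩ :=
    { seq := fun t => ⨆ i ∈ Set.Iio t, ξ i
      mono' := fun s t hst => biSup_mono fun i hi => lt_of_lt_of_le hi hst
      le' := fun t => iSup₂_le fun i _ => hξ i }
  have hξℱ : ∀ t, ξ t ≤ ℱ (t + 1) := fun t => le_biSup ξ (Set.mem_Iio.2 t.lt_succ_self)
  have hpair : ∀ t, Measurable[ℱ (t + 1)] fun ω => (X t ω, Y t ω) := fun t =>
    measurable_iff_comap_le.2 (hξℱ t)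
  have hXℱ : ∀ t, Measurable[ℱ (t + 1)] (X t) := fun t => measurable_fst.comp (hpair t)
  have hYℱ : ∀ t, Measurable[ℱ (t + 1)] (Y t) := fun t => measurable_snd.comp (hpair t)
  have hrun := measurableState_run I hs_meas hXℱ hYℱ
  have hpast : ∀ t, Indep (ℱ t) (ξ t) P := fun t => by
    have := indep_iSup_of_disjoint hξ hindep.iIndep
      (S := Set.Iio t) (T := {t}) (by simp)
    simpa only [iSup_singleton] using this
  have hm : Measurable fun r : Fin K → ℝ => I.s ℓ k (r k) := (hs_meas ℓ k).comp (measurable_pi_apply k)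
  have hm₁ : ∀ t, MeasurableSet[ℱ t] {ω | k = m₁ I t (run I (X · ω) (Y · ω) t)} := fun t =>
    (@measurableSet_setOfPred _ (ℱ t) _).2 (@MeasurableState.m₁_eq K Ω (ℱ t) _ I t (hrun t) k)
  have hm₂ : ∀ t, MeasurableSet[ℱ t] {ω | k = m₂ I t (run I (X · ω) (Y · ω) t)} := fun t =>
    (@measurableSet_setOfPred _ (ℱ t) _).2 (@MeasurableState.m₂_eq K Ω (ℱ t) _ I t (hrun t) k)
  have hcard : ∀ t, MeasurableSet[ℱ t] {ω | 1 < (run I (X · ω) (Y · ω) t).active.card} := fun t =>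
    (@measurableSet_setOfPred _ (ℱ t) _).2 (@MeasurableState.one_lt_card K Ω (ℱ t) _ (hrun t))
  have hD : ∀ t, MeasurableSet[ℱ t] (sampledAt I X Y k t) := fun t =>
    (hcard t).inter ((hm₁ t).union (hm₂ t))
  have hV : ∀ t, Measurable[ℱ (t + 1)] (pseudoReward I X Y ℓ k t) := fun t =>
    Measurable.ite (ℱ.mono t.le_succ _ (hm₁ t)) (hm.comp (hXℱ t)) (hm.comp (hYℱ t))
  have hVρ : ∀ t, Indep (ℱ t) (MeasurableSpace.comap (pseudoReward I X Y ℓ k t) inferInstance) P ∧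
      P.map (pseudoReward I X Y ℓ k t) = ν.map fun r => I.s ℓ k (r k) := fun t => by
    refine indep_ite_of_indep (ℱ.le t) (hm.comp (hX t)) (hm.comp (hY t)) ?_ ?_ ?_ ?_ (hm₁ t)
    · exact indep_of_indep_of_le_right (hpast t)
        (measurable_iff_comap_le.1 ((hm.comp measurable_fst).comp (comap_measurable _)))
    · exact indep_of_indep_of_le_right (hpast t)
        (measurable_iff_comap_le.1 ((hm.comp measurable_snd).comp (comap_measurable _)))
    · rw [← hXν t, Measure.map_map hm (hX t)]
      rfl
    · rw [← hYν t, Measure.map_map hm (hY t)]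
      rfl
  have : IsProbabilityMeasure (ν.map fun r => I.s ℓ k (r k)) :=
    Measure.isProbabilityMeasure_map hm.aemeasurable
  have hρ : ∀ᵐ r ∂(ν.map fun r => I.s ℓ k (r k)), r ∈ Set.Icc 0 I.b := by
    refine (ae_map_iff hm.aemeasurable measurableSet_Icc).2 ?_
    filter_upwards [hbdd] with r hr using hs_range ℓ k _ (hr k)
  refine le_trans (measure_mono ?_) (hB.measure_selected_le hρ hV hD (fun t => (hVρ t).1)
    (fun t => (hVρ t).2) hη)
  rintro ω ⟨t, ht, h1, h2⟩
  obtain ⟨hn, hS⟩ := selected_pseudoReward hpick ℓ k ω t ht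
  refine ⟨t, by rwa [hn], ?_⟩
  rw [hS, hn, integral_map hm.aemeasurable (by fun_prop)]
  exact h2

end Deviation

/-! ### Pathwise consequences of the confidence bounds: correctness. -/

/-- The state `σ` obeys the confidence bounds that the analysis needs: `φ k` is the mean of the
pseudo-reward of the best arm with respect to arm `k`, and `μ k` the mean of arm `k`. -/
structure Accurate (I : Input K) (kstar : Fin K) (φ μ : Fin K → ℝ) (σ : State K) : Prop where
  phi : ∀ k, 1 ≤ σ.n k → |phiHat σ kstar k - φ k| ≤ I.B (σ.n k) (I.δ / (3 * K))
  mu : ∀ k, 1 ≤ σ.n k → |phiHat σ k k - μ k| ≤ I.B (σ.n k) (I.δ / (3 * K))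
  best : 1 ≤ σ.n kstar → |phiHat σ kstar kstar - μ kstar| ≤ I.B (σ.n kstar) (I.δ / 4)

section Indices

variable {I : Input K} {kstar : Fin K} {φ μ : Fin K → ℝ} {σ : State K}

lemma Accurate.lcb_le (hσ : Accurate I kstar φ μ σ) (k : Fin K) :
    lcb I σ (I.δ / (3 * K)) k ≤ μ k := by
  unfold lcb
  split_ifs with h
  · exact bot_le
  · have := abs_le.1 (hσ.mu k (by omega))
    exact EReal.coe_le_coe_iff.2 (by linarith)

lemma Accurate.le_crossUCBmin (hσ : Accurate I kstar φ μ σ) (hφ : ∀ k, μ kstar ≤ φ k) :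
    (μ kstar : EReal) ≤ crossUCBmin I σ (I.δ / (3 * K)) kstar := by
  refine le_iInf fun k => ?_
  unfold crossUCB
  split_ifs with h
  · exact le_top
  · have := abs_le.1 (hσ.phi k (by omega))
    exact EReal.coe_le_coe_iff.2 (by linarith [hφ k])

lemma Accurate.le_crossUCB (hσ : Accurate I kstar φ μ σ) :
    (μ kstar : EReal) ≤ crossUCB I σ (I.δ / 4) kstar kstar := by
  unfold crossUCB
  split_ifs with h
  · exact le_top
  · have := abs_le.1 (hσ.best (by omega))
    exact EReal.coe_le_coe_iff.2 (by linarith)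

lemma lcb_mono {η η' : ℝ} (hanti : ∀ n, 1 ≤ n → AntitoneOn (I.B n) (Set.Ioo 0 1))
    (hη : η ∈ Set.Ioo (0 : ℝ) 1) (hη' : η' ∈ Set.Ioo (0 : ℝ) 1) (hle : η ≤ η') (k : Fin K) :
    lcb I σ η k ≤ lcb I σ η' k := by
  unfold lcb
  split_ifs with h
  · exact bot_le
  · have := hanti (σ.n k) (by omega) hη hη' hle
    exact EReal.coe_le_coe_iff.2 (by linarith)

lemma Accurate.mem_active_eliminate (hσ : Accurate I kstar φ μ σ) (hφ : ∀ k, μ kstar ≤ φ k)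
    (hμ : ∀ k, μ k ≤ μ kstar) (hmem : kstar ∈ σ.active) :
    kstar ∈ (eliminate I σ).active := by
  refine Finset.mem_filter.2 ⟨hmem, not_lt.2 ?_⟩
  refine (Finset.sup_le fun ℓ _ => ?_).trans (hσ.le_crossUCBmin hφ)
  exact (hσ.lcb_le ℓ).trans (EReal.coe_le_coe_iff.2 (hμ ℓ))

lemma notMem_active_eliminate {k ℓ : Fin K} (hℓ : ℓ ∈ σ.active)
    (h : crossUCB I σ (I.δ / (3 * K)) k k < lcb I σ (I.δ / (3 * K)) ℓ) :
    k ∉ (eliminate I σ).active := fun hk =>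
  (Finset.mem_filter.1 hk).2 (Finset.lt_sup_iff.2 ⟨ℓ, hℓ, (iInf_le _ k).trans_lt h⟩)

end Indices

section Run

variable {I : Input K} {x y : ℕ → Fin K → ℝ} {kstar : Fin K} {φ μ : Fin K → ℝ}

lemma n_run_succ (t : ℕ) (k : Fin K) :
    (run I x y (t + 1)).n k = (run I x y t).n k + (if k = m₁ I t (run I x y t) then 1 else 0)
      + (if k = m₂ I t (run I x y t) then 1 else 0) := rfl

lemma n_run_mono (k : Fin K) : Monotone fun t => (run I x y t).n k :=
  monotone_nat_of_le_succ fun t => by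
    rw [n_run_succ]
    omega

lemma active_run_anti : Antitone fun t => (run I x y t).active :=
  antitone_nat_of_succ_le fun _ => Finset.filter_subset _ _

lemma kstar_mem_active_run
    (hacc : ∀ t, (∀ i < t, 1 < (run I x y i).active.card) → Accurate I kstar φ μ (run I x y t))
    (hφ : ∀ k, μ kstar ≤ φ k) (hμ : ∀ k, μ k ≤ μ kstar) (t : ℕ)
    (ht : ∀ i < t, 1 < (run I x y i).active.card) : kstar ∈ (run I x y t).active := by
  induction t with
  | zero => exact Finset.mem_univ _
  | succ t ih =>
    have h := hacc (t + 1) ht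
    -- Elimination changes neither counts nor sums, so accuracy carries over to the state just
    -- before it.
    have hs : Accurate I kstar φ μ (sample I t (run I x y t) (x t) (y t)) := ⟨h.phi, h.mu, h.best⟩
    exact hs.mem_active_eliminate hφ hμ (ih fun i hi => ht i (by omega))

/-- If the confidence bounds hold and the algorithm stops, it declares the best arm. -/
lemma m₁_eq_of_stops {σ : State K} {t : ℕ} (hpick : ∀ t S, S.Nonempty → I.pick t S ∈ S)
    (hanti : ∀ n, 1 ≤ n → AntitoneOn (I.B n) (Set.Ioo 0 1)) (hδ : I.δ ∈ Set.Ioo (0 : ℝ) 1)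
    (hσ : Accurate I kstar φ μ σ) (hμ : ∀ k, μ k ≤ μ kstar)
    (hmem : kstar ∈ σ.active) (hhalt : Stops I t σ) : m₁ I t σ = kstar := by
  rcases hhalt with h | ⟨-, h⟩
  · obtain ⟨a, ha⟩ := Finset.card_eq_one.1 h
    have h1 := m₁_mem_active (t := t) hpick ⟨kstar, hmem⟩
    rw [ha, Finset.mem_singleton] at hmem h1
    exact h1.trans hmem.symm
  · by_contra hne
    have hlt := h kstar (Finset.mem_erase.2 ⟨Ne.symm hne, hmem⟩)
    have hK : (1 : ℝ) ≤ K := by exact_mod_cast Fin.pos kstar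
    have hδ0 := hδ.1
    have hδ1 := hδ.2
    have h4 : I.δ / (4 * K) ∈ Set.Ioo (0 : ℝ) 1 :=
      ⟨by positivity, by rw [div_lt_one (by positivity)]; linarith⟩
    have h3 : I.δ / (3 * K) ∈ Set.Ioo (0 : ℝ) 1 :=
      ⟨by positivity, by rw [div_lt_one (by positivity)]; linarith⟩
    have hle : I.δ / (4 * K) ≤ I.δ / (3 * K) := by gcongr; norm_num
    -- The chain is μ_{k*} ≤ Ũ_{k*,k*}(δ/4) < L_{m₁}(δ/(4K)) ≤ L_{m₁}(δ/(3K)) ≤ μ_{m₁}.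
    refine absurd (hσ.le_crossUCB.trans_lt (hlt.trans_le
      ((lcb_mono hanti h4 h3 hle _).trans (hσ.lcb_le _)))) ?_
    exact not_lt.2 (EReal.coe_le_coe_iff.2 (hμ _))

end Run
-- PseudoUCB indices of the best arm and of the others.
section PseudoUCB

variable {I : Input K} {kstar : Fin K} {φ μ : Fin K → ℝ} {ε : ℝ}

/-- With many samples of `k` the deviation is at most `ε`; with few, the logarithmic bonus
eventually exceeds the supremum bound `M` of the deviation. -/
lemma eventually_le_pseudoUCBmin (hb : 0 < I.b)
    (hlim : Tendsto (fun n => I.B n (I.δ / (3 * K))) atTop (𝓝 0)) (hφ : ∀ k, μ kstar ≤ φ k)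
    (hε : 0 < ε) :
    ∃ T : ℕ, ∀ t ≥ T, ∀ σ, Accurate I kstar φ μ σ →
      ((μ kstar - ε : ℝ) : EReal) ≤ pseudoUCBmin I t σ kstar := by
  obtain ⟨n₀, hn₀⟩ := eventually_atTop.1 (hlim.eventually (ge_mem_nhds hε))
  obtain ⟨M, hM⟩ := hlim.bddAbove_range
  have htend : Tendsto (fun t : ℕ => I.b * Real.sqrt (2 * Real.log t / (n₀ + 1 : ℕ))) atTop atTop :=
    (Real.tendsto_sqrt_atTop.comp (((Real.tendsto_log_atTop.comp
      tendsto_natCast_atTop_atTop).const_mul_atTop two_pos).atTop_div_const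
        (by positivity))).const_mul_atTop hb
  obtain ⟨T, hT⟩ := eventually_atTop.1 (htend.eventually_ge_atTop M)
  refine ⟨T, fun t ht σ hσ => le_iInf fun k => ?_⟩
  unfold pseudoUCB
  split_ifs with h
  · exact le_top
  refine EReal.coe_le_coe_iff.2 ?_
  have hdev := abs_le.1 (hσ.phi k (by omega))
  have hφk := hφ k
  rcases le_total n₀ (σ.n k) with hn | hn
  · have := hn₀ _ hn
    have : 0 ≤ I.b * Real.sqrt (2 * Real.log t / σ.n k) := by positivity
    linarith
  · have hBM : I.B (σ.n k) (I.δ / (3 * K)) ≤ M := hM ⟨_, rfl⟩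
    have hbonus : I.b * Real.sqrt (2 * Real.log t / (n₀ + 1 : ℕ))
        ≤ I.b * Real.sqrt (2 * Real.log t / σ.n k) := by
      have hlog := Real.log_natCast_nonneg t
      have hpos : (0 : ℝ) < σ.n k := by exact_mod_cast Nat.pos_of_ne_zero h
      have hle : (σ.n k : ℝ) ≤ (n₀ + 1 : ℕ) := by exact_mod_cast hn.trans n₀.le_succ
      gcongr
    linarith [hT t ht]

/-- Beyond `n₀` samples μ̂_k ≤ μ_k + ε ≤ μ_{k*} - 2ε, so the bonus must be at least `ε`; squaring
bounds the count. -/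
lemma exists_n_le_of_le_pseudoUCBmin (hb : 0 < I.b)
    (hlim : Tendsto (fun n => I.B n (I.δ / (3 * K))) atTop (𝓝 0)) (hε : 0 < ε) :
    ∃ c C : ℝ, 0 ≤ c ∧ 0 ≤ C ∧ ∀ t σ k, Accurate I kstar φ μ σ → μ k + 3 * ε ≤ μ kstar →
      ((μ kstar - ε : ℝ) : EReal) ≤ pseudoUCBmin I t σ k → (σ.n k : ℝ) ≤ c + C * Real.log t := by
  obtain ⟨n₀, hn₀⟩ := eventually_atTop.1 (hlim.eventually (ge_mem_nhds hε))
  refine ⟨n₀, 2 * I.b ^ 2 / ε ^ 2, by positivity, by positivity, fun t σ k hσ hgap hle => ?_⟩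
  have hlog := Real.log_natCast_nonneg t
  have hC : 0 ≤ 2 * I.b ^ 2 / ε ^ 2 * Real.log t := by positivity
  rcases le_total (σ.n k) n₀ with hn | hn
  · have : (σ.n k : ℝ) ≤ n₀ := by exact_mod_cast hn
    linarith
  by_cases h : σ.n k = 0
  · rw [h]
    push_cast
    positivity
  have hpos : (0 : ℝ) < σ.n k := by exact_mod_cast Nat.pos_of_ne_zero h
  have hkk := hle.trans (iInf_le _ k)
  rw [pseudoUCB, if_neg h, EReal.coe_le_coe_iff] at hkk
  have hdev := abs_le.1 (hσ.mu k (by omega))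
  have hbonus : ε ≤ I.b * Real.sqrt (2 * Real.log t / σ.n k) := by linarith [hn₀ _ hn]
  have hsq : ε ^ 2 ≤ I.b ^ 2 * (2 * Real.log t / σ.n k) := by
    have := pow_le_pow_left₀ hε.le hbonus 2
    rwa [mul_pow, Real.sq_sqrt (by positivity)] at this
  have hn' : (σ.n k : ℝ) ≤ 2 * I.b ^ 2 / ε ^ 2 * Real.log t := by
    rw [div_mul_eq_mul_div, le_div_iff₀ (by positivity)]
    rw [mul_div_assoc', le_div_iff₀ hpos] at hsq
    linarith
  have : (0 : ℝ) ≤ n₀ := by positivity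
  linarith

end PseudoUCB

/-! ### Termination on the good event. -/

section Termination

variable {I : Input K} {x y : ℕ → Fin K → ℝ} {kstar : Fin K} {φ μ : Fin K → ℝ} {ε : ℝ}

lemma card_m₁_eq_le_n (k : Fin K) (T : ℕ) :
    ((Finset.range T).filter fun t => m₁ I t (run I x y t) = k).card ≤ (run I x y T).n k := by
  induction T with
  | zero => simp
  | succ T ih =>
    rw [Finset.range_add_one, Finset.filter_insert, n_run_succ]
    by_cases h : m₁ I T (run I x y T) = k
    · rw [if_pos h, if_pos h.symm, Finset.card_insert_of_notMem (by simp)]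
      omega
    · rw [if_neg h, if_neg (Ne.symm h)]
      omega

lemma n_kstar_unbounded (hb : 0 < I.b)
    (hlim : Tendsto (fun n => I.B n (I.δ / (3 * K))) atTop (𝓝 0)) (hφ : ∀ k, μ kstar ≤ φ k)
    (hε : 0 < ε) (hgap : ∀ k, k ≠ kstar → μ k + 3 * ε ≤ μ kstar)
    (hpick : ∀ t S, S.Nonempty → I.pick t S ∈ S)
    (hacc : ∀ t, Accurate I kstar φ μ (run I x y t))
    (hmem : ∀ t, kstar ∈ (run I x y t).active) (N : ℕ) : ∃ t, N ≤ (run I x y t).n kstar := by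
  by_contra! hN
  obtain ⟨T₀, hT₀⟩ := eventually_le_pseudoUCBmin hb hlim hφ hε
  obtain ⟨c, C, hc, hC, hn⟩ := exists_n_le_of_le_pseudoUCBmin (φ := φ) (μ := μ) (kstar := kstar)
    hb hlim hε
  -- The count grows only when m₁ = k, and then it is controlled by n_k: `T₀` covers the early
  -- rounds, `1` the current one.
  have hcount : ∀ k, k ≠ kstar → ∀ T : ℕ,
      (((Finset.range T).filter fun t => m₁ I t (run I x y t) = k).card : ℝ)
        ≤ T₀ + c + 1 + C * Real.log T := by
    intro k hk T
    induction T with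
    | zero => simp; positivity
    | succ T ih =>
      have hlog : Real.log T ≤ Real.log (T + 1 : ℕ) := by
        rcases T.eq_zero_or_pos with rfl | hT
        · simp
        · exact Real.log_le_log (by exact_mod_cast hT) (by exact_mod_cast T.le_succ)
      have hClog := mul_le_mul_of_nonneg_left hlog hC
      rw [Finset.range_add_one, Finset.filter_insert]
      split_ifs with h
      · rw [Finset.card_insert_of_notMem (by simp)]
        push_cast
        rcases lt_or_ge T T₀ with hT | hT
        · have h1 : ((Finset.range T).filter fun t => m₁ I t (run I x y t) = k).card ≤ T :=
            (Finset.card_filter_le _ _).trans (Finset.card_range T).le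
          have h2 : (((Finset.range T).filter fun t => m₁ I t (run I x y t) = k).card : ℝ) ≤ T₀ := by
            exact_mod_cast h1.trans hT.le
          have h3 : 0 ≤ C * Real.log (T + 1 : ℕ) := mul_nonneg hC (Real.log_natCast_nonneg _)
          push_cast at h3
          linarith
        · have hmax := m₁_mem_argmaxOn (t := T) hpick ⟨kstar, hmem T⟩
          rw [h] at hmax
          have h1 := hn T _ k (hacc T) (hgap k hk)
            ((hT₀ T hT _ (hacc T)).trans ((Finset.mem_filter.1 hmax).2 kstar (hmem T)))
          have h2 : (((Finset.range T).filter fun t => m₁ I t (run I x y t) = k).card : ℝ)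
              ≤ (run I x y T).n k := by exact_mod_cast card_m₁_eq_le_n k T
          push_cast at hClog
          have h3 : (0 : ℝ) ≤ T₀ := by positivity
          linarith
      · linarith
  -- Every round has one m₁; summing over arms makes T at most O(log T) if k* stays below `N`.
  have htotal : ∀ T : ℕ, (T : ℝ) ≤ N + K * (T₀ + c + 1 + C * Real.log T) := by
    intro T
    have h1 : ((Finset.range T).card : ℝ) = ∑ k : Fin K,
        (((Finset.range T).filter fun t => m₁ I t (run I x y t) = k).card : ℝ) := by
      exact_mod_cast Finset.card_eq_sum_card_fiberwise fun t _ => Finset.mem_coe.2 (Finset.mem_univ _)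
    rw [Finset.card_range] at h1
    have hlog := Real.log_natCast_nonneg T
    have h2 : ∀ k : Fin K, (((Finset.range T).filter fun t => m₁ I t (run I x y t) = k).card : ℝ)
        ≤ (if k = kstar then (N : ℝ) else 0) + (T₀ + c + 1 + C * Real.log T) := by
      intro k
      split_ifs with hk
      · have : (((Finset.range T).filter fun t => m₁ I t (run I x y t) = k).card : ℝ) ≤ N := by
          rw [hk]
          exact_mod_cast (card_m₁_eq_le_n kstar T).trans (hN T).le
        have : 0 ≤ T₀ + c + 1 + C * Real.log T := by positivity
        linarith
      · linarith [hcount k hk T]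
    calc (T : ℝ) ≤ ∑ k : Fin K, ((if k = kstar then (N : ℝ) else 0)
          + (T₀ + c + 1 + C * Real.log T)) := h1.le.trans (Finset.sum_le_sum fun k _ => h2 k)
      _ = N + K * (T₀ + c + 1 + C * Real.log T) := by
          simp [Finset.sum_add_distrib]
          ring
  have hlogo : Tendsto (fun T : ℕ => Real.log T / T) atTop (𝓝 0) :=
    (Real.isLittleO_log_id_atTop.tendsto_div_nhds_zero).comp tendsto_natCast_atTop_atTop
  have hlim0 : Tendsto (fun T : ℕ => (N + K * (T₀ + c + 1)) / T + K * C * (Real.log T / T))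
      atTop (𝓝 (0 + K * C * 0)) :=
    (tendsto_const_nhds.div_atTop tendsto_natCast_atTop_atTop).add (hlogo.const_mul _)
  rw [mul_zero, add_zero] at hlim0
  obtain ⟨T, hT, hT1⟩ := ((hlim0.eventually (gt_mem_nhds one_pos)).and
    (eventually_ge_atTop 1)).exists
  have hpos : (0 : ℝ) < T := by exact_mod_cast hT1
  rw [← mul_div_assoc, ← add_div, div_lt_one hpos] at hT
  linarith [htotal T]

lemma n_bounded_of_ne (hpick : ∀ t S, S.Nonempty → I.pick t S ∈ S)
    (hlim : Tendsto (fun n => I.B n (I.δ / (3 * K))) atTop (𝓝 0))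
    (hε : 0 < ε) (hacc : ∀ t, Accurate I kstar φ μ (run I x y t))
    (hmem : ∀ t, kstar ∈ (run I x y t).active) (hcard : ∀ t, 1 < (run I x y t).active.card)
    (hkstar : ∀ N, ∃ t, N ≤ (run I x y t).n kstar) {k : Fin K} (hk : μ k + 5 * ε ≤ μ kstar) :
    ∃ N, ∀ t, (run I x y t).n k ≤ N := by
  by_contra! hunb
  obtain ⟨n₀, hn₀⟩ := eventually_atTop.1 (hlim.eventually (ge_mem_nhds hε))
  obtain ⟨t₁, ht₁⟩ := hkstar (n₀ + 1)
  obtain ⟨t₂, ht₂⟩ := hunb n₀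
  obtain ⟨T, hT₁, hT₂⟩ : ∃ T, t₁ ≤ T + 1 ∧ t₂ ≤ T + 1 := ⟨max t₁ t₂, by omega, by omega⟩
  have h₁ : n₀ + 1 ≤ (run I x y (T + 1)).n kstar := ht₁.trans (n_run_mono kstar hT₁)
  have h₂ : n₀ + 1 ≤ (run I x y (T + 1)).n k := (Nat.succ_le_of_lt ht₂).trans (n_run_mono k hT₂)
  have hout : k ∉ (run I x y (T + 1)).active := by
    refine notMem_active_eliminate (σ := sample I T (run I x y T) (x T) (y T)) (hmem T) ?_
    -- Four deviations of at most `ε` fit into the gap 5ε with strict inequality.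
    have hU : crossUCB I (run I x y (T + 1)) (I.δ / (3 * K)) k k
        < lcb I (run I x y (T + 1)) (I.δ / (3 * K)) kstar := by
      rw [crossUCB, lcb, if_neg (by omega), if_neg (by omega), EReal.coe_lt_coe_iff]
      have d₁ := abs_le.1 ((hacc (T + 1)).mu kstar (by omega))
      have d₂ := abs_le.1 ((hacc (T + 1)).mu k (by omega))
      linarith [hn₀ _ (n₀.le_succ.trans h₁), hn₀ _ (n₀.le_succ.trans h₂)]
    exact hU
  have hconst : ∀ s, (run I x y (T + 1 + s)).n k = (run I x y (T + 1)).n k := by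
    intro s
    induction s with
    | zero => rfl
    | succ s ih =>
      have hout' : k ∉ (run I x y (T + 1 + s)).active := fun h =>
        hout (active_run_anti (Nat.le_add_right _ _) h)
      rw [← add_assoc, n_run_succ, ih, if_neg, if_neg, add_zero, add_zero]
      · intro h
        exact hout' (h ▸ Finset.mem_of_mem_erase (m₂_mem_erase hpick (hcard (T + 1 + s))))
      · intro h
        exact hout' (h ▸ m₁_mem_active hpick ⟨kstar, hmem (T + 1 + s)⟩)
  obtain ⟨t, ht⟩ := hunb ((run I x y (T + 1)).n k)
  have := n_run_mono (I := I) (x := x) (y := y) k (Nat.le_add_left t (T + 1))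
  simp only [hconst] at this
  omega

lemma le_sum_n_of_ne (hpick : ∀ t S, S.Nonempty → I.pick t S ∈ S)
    (hcard : ∀ t, 1 < (run I x y t).active.card) (kstar : Fin K) (t : ℕ) :
    t ≤ ∑ k ∈ Finset.univ.erase kstar, (run I x y t).n k := by
  induction t with
  | zero => exact Nat.zero_le _
  | succ t ih =>
    refine Nat.succ_le_of_lt (ih.trans_lt (Finset.sum_lt_sum
      (fun k _ => n_run_mono k t.le_succ) ?_))
    have hne := Finset.ne_of_mem_erase (m₂_mem_erase (t := t) hpick (hcard t))
    by_cases h : m₁ I t (run I x y t) = kstar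
    · refine ⟨m₂ I t (run I x y t), by simpa [← h] using hne, ?_⟩
      rw [n_run_succ, if_pos rfl]
      omega
    · refine ⟨m₁ I t (run I x y t), by simpa using h, ?_⟩
      rw [n_run_succ, if_pos rfl]
      omega

/-- If the confidence bounds hold before the stopping time, then the algorithm stops, and declares
the best arm. -/
theorem declares_of_accurate (hb : 0 < I.b) (hδ : I.δ ∈ Set.Ioo (0 : ℝ) 1)
    (hanti : ∀ n, 1 ≤ n → AntitoneOn (I.B n) (Set.Ioo 0 1))
    (hlim : Tendsto (fun n => I.B n (I.δ / (3 * K))) atTop (𝓝 0))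
    (hpick : ∀ t S, S.Nonempty → I.pick t S ∈ S)
    (hφ : ∀ k, μ kstar ≤ φ k) (hμ : ∀ k, k ≠ kstar → μ k < μ kstar)
    (hacc : ∀ t, (∀ i < t, 1 < (run I x y i).active.card) → Accurate I kstar φ μ (run I x y t)) :
    Declares I x y kstar := by
  classical
  have hμ' : ∀ k, μ k ≤ μ kstar := fun k => by
    rcases eq_or_ne k kstar with rfl | hk
    exacts [le_rfl, (hμ k hk).le]
  have hcard : ∀ t, (∀ i < t, ¬ Stops I i (run I x y i)) →
      ∀ i < t, 1 < (run I x y i).active.card := by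
    intro t ht i
    -- Accuracy at round `i` requires two active arms earlier; it keeps k* active, and not stopping
    -- rules out a single arm.
    induction i using Nat.strong_induction_on with
    | _ i ih =>
      intro hi
      have hmem := kstar_mem_active_run hacc hφ hμ' i fun j hj => ih j hj (hj.trans hi)
      have hpos := Finset.card_pos.2 ⟨kstar, hmem⟩
      have hne : (run I x y i).active.card ≠ 1 := fun h => ht i hi (Or.inl h)
      omega
  have hhalt : ∃ T, Stops I T (run I x y T) := by
    by_contra! hns
    have hcard' : ∀ t, 1 < (run I x y t).active.card := fun t =>
      hcard (t + 1) (fun i _ => hns i) t t.lt_succ_self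
    have hacc' := fun t => hacc t fun i _ => hcard' i
    have hmem := fun t => kstar_mem_active_run hacc hφ hμ' t fun i _ => hcard' i
    obtain ⟨ε, hε, hgap⟩ : ∃ ε : ℝ, 0 < ε ∧ ∀ k, k ≠ kstar → μ k + 5 * ε ≤ μ kstar := by
      have hne : (Finset.univ : Finset (Fin K)).Nonempty := ⟨kstar, Finset.mem_univ _⟩
      obtain ⟨a, -, ha⟩ := Finset.univ.exists_min_image
        (fun k => if k = kstar then 1 else μ kstar - μ k) hne
      refine ⟨(if a = kstar then 1 else μ kstar - μ a) / 5, ?_, fun k hk => ?_⟩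
      · split_ifs with h
        · norm_num
        · have := hμ a h
          linarith
      · have := ha k (Finset.mem_univ _)
        rw [if_neg hk] at this
        linarith
    have hkstar := n_kstar_unbounded hb hlim hφ hε
      (fun k hk => by linarith [hgap k hk]) hpick hacc' hmem
    have hbound : ∀ k, ∃ N, k ≠ kstar → ∀ t, (run I x y t).n k ≤ N := fun k => by
      by_cases hk : k = kstar
      · exact ⟨0, fun h => absurd hk h⟩
      · obtain ⟨N, hN⟩ := n_bounded_of_ne hpick hlim hε hacc' hmem hcard' hkstar (hgap k hk)
        exact ⟨N, fun _ => hN⟩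
    choose N hN using hbound
    have h1 := le_sum_n_of_ne hpick hcard' kstar (∑ k ∈ Finset.univ.erase kstar, N k + 1)
    have h2 := Finset.sum_le_sum fun k (hk : k ∈ Finset.univ.erase kstar) =>
      hN k (Finset.ne_of_mem_erase hk) (∑ k ∈ Finset.univ.erase kstar, N k + 1)
    omega
  have hbefore := hcard (Nat.find hhalt) fun i hi => Nat.find_min hhalt hi
  exact ⟨Nat.find hhalt, Nat.find_spec hhalt, fun t ht => Nat.find_min hhalt ht,
    m₁_eq_of_stops hpick hanti hδ (hacc _ hbefore) hμ'
      (kstar_mem_active_run hacc hφ hμ' _ hbefore) (Nat.find_spec hhalt)⟩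

end Termination
end CLUCBpp

/-! ### Union bound and conclusion. -/

lemma integral_le_integral_of_condExp_le {Ω : Type*} {m m₀ : MeasurableSpace Ω} {ν : Measure Ω}
    [IsFiniteMeasure ν] (hm : m ≤ m₀) {f g : Ω → ℝ} (hg : Integrable g ν) (h : ν[f | m] ≤ᵐ[ν] g) :
    ∫ ω, f ω ∂ν ≤ ∫ ω, g ω ∂ν := by
  rw [← integral_condExp hm]
  exact integral_mono_ae integrable_condExp hg h

theorem mainTheorem4
    {Ω : Type*} [MeasurableSpace Ω] (P : Measure Ω) [IsProbabilityMeasure P]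
    -- the arms, the joint law `ν` of their rewards, which lie in `[0, b]`
    {K : ℕ} (ν : Measure (Fin K → ℝ)) [IsProbabilityMeasure ν]
    (b : ℝ) (hb : 0 < b) (hbdd : ∀ᵐ r ∂ν, ∀ k, r k ∈ Set.Icc 0 b)
    -- the best arm
    (kstar : Fin K) (hbest : ∀ k, k ≠ kstar → ∫ r, r k ∂ν < ∫ r, r kstar ∂ν)
    -- the pseudo-rewards
    (s : Fin K → Fin K → ℝ → ℝ) (hs_meas : ∀ ℓ k, Measurable (s ℓ k))
    (hs_range : ∀ ℓ k, ∀ r ∈ Set.Icc 0 b, s ℓ k r ∈ Set.Icc 0 b)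
    (hs_diag : ∀ k r, s k k r = r)
    (hs : ∀ ℓ k, ν[fun r => r ℓ | MeasurableSpace.comap (fun r : Fin K → ℝ => r k) inferInstance]
      ≤ᵐ[ν] fun r => s ℓ k (r k))
    -- the anytime confidence bound
    (B : ℕ → ℝ → ℝ) (hB : IsAnytimeConfidenceBound b B)
    (hB_anti : ∀ n, 1 ≤ n → AntitoneOn (B n) (Set.Ioo 0 1))
    (hB_lim : ∀ η ∈ Set.Ioo (0 : ℝ) 1, Tendsto (fun n => B n η) atTop (𝓝 0))
    -- the confidence parameter and the tie-breaking rule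
    (δ : ℝ) (hδ : 0 < δ)
    (pick : ℕ → Finset (Fin K) → Fin K) (hpick : ∀ t S, S.Nonempty → pick t S ∈ S)
    -- the reward vectors of the successive rounds, for the first and the second sampled arm
    (X Y : ℕ → Ω → Fin K → ℝ) (hX : ∀ t, Measurable (X t)) (hY : ∀ t, Measurable (Y t))
    (hXν : ∀ t, P.map (X t) = ν) (hYν : ∀ t, P.map (Y t) = ν)
    (hindep : iIndepFun (fun t ω => (X t ω, Y t ω)) P) :
    1 - δ ≤ P.real {ω | CLUCBpp.Declares ⟨b, B, s, δ, pick⟩ (fun t => X t ω) (fun t => Y t ω) kstar} := by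
  rcases le_or_gt 1 δ with hδ1 | hδ1
  · exact (sub_nonpos.2 hδ1).trans measureReal_nonneg
  set I : CLUCBpp.Input K := ⟨b, B, s, δ, pick⟩ with hI
  have hK : (1 : ℝ) ≤ K := by exact_mod_cast Fin.pos kstar
  have h3 : δ / (3 * K) ∈ Set.Ioo (0 : ℝ) 1 :=
    ⟨by positivity, by rw [div_lt_one (by positivity)]; linarith⟩
  have h4 : δ / 4 ∈ Set.Ioo (0 : ℝ) 1 := ⟨by positivity, by linarith⟩
  have hφ : ∀ k, ∫ r, r kstar ∂ν ≤ ∫ r, s kstar k (r k) ∂ν := fun k => by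
    refine integral_le_integral_of_condExp_le (measurable_pi_apply k).comap_le ?_ (hs kstar k)
    refine Integrable.of_mem_Icc 0 b ((hs_meas kstar k).comp (measurable_pi_apply k)).aemeasurable ?_
    filter_upwards [hbdd] with r hr using hs_range kstar k _ (hr k)
  -- the bound of level `η` for the pseudo-rewards of `ℓ` with respect to `k` fails before stopping
  let F : Fin K → Fin K → ℝ → Set Ω := fun ℓ k η =>
    {ω | ∃ t, (∀ i < t, 1 < (CLUCBpp.run I (X · ω) (Y · ω) i).active.card) ∧
      1 ≤ (CLUCBpp.run I (X · ω) (Y · ω) t).n k ∧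
      B ((CLUCBpp.run I (X · ω) (Y · ω) t).n k) η <
        |CLUCBpp.phiHat (CLUCBpp.run I (X · ω) (Y · ω) t) ℓ k - ∫ r, s ℓ k (r k) ∂ν|}
  have hF : ∀ ℓ k, ∀ η ∈ Set.Ioo (0 : ℝ) 1, P.real (F ℓ k η) ≤ η := fun ℓ k η hη =>
    ENNReal.toReal_le_of_le_ofReal hη.1.le (CLUCBpp.measure_phiHat_deviation_le (I := I) hbdd hs_meas
      hs_range hB hpick hX hY hXν hYν hindep ℓ k hη)
  -- The second family omits k*: since s_{k*,k*}(r) = r, the first one contains that event.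
  let G : Set Ω := (⋃ k ∈ (Finset.univ : Finset (Fin K)), F kstar k (δ / (3 * K))) ∪
    (⋃ k ∈ Finset.univ.erase kstar, F k k (δ / (3 * K))) ∪ F kstar kstar (δ / 4)
  have hG : P.real G ≤ δ := by
    have hsum : ∀ (A : Finset (Fin K)) (f : Fin K → Fin K),
        P.real (⋃ k ∈ A, F (f k) k (δ / (3 * K))) ≤ A.card * (δ / (3 * K)) := fun A f => by
      refine (measureReal_biUnion_finset_le _ _).trans
        ((Finset.sum_le_sum fun k _ => hF (f k) k _ h3).trans ?_)
      rw [Finset.sum_const, nsmul_eq_mul]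
    have h1 := hsum Finset.univ fun _ => kstar
    have h2 := hsum (Finset.univ.erase kstar) id
    have hle : ((Finset.univ.erase kstar).card : ℝ) ≤ K := by
      exact_mod_cast (Finset.card_le_univ _).trans (Fintype.card_fin K).le
    have h2' := h2.trans (mul_le_mul_of_nonneg_right hle h3.1.le)
    have hthird : K * (δ / (3 * K)) = δ / 3 := by field_simp
    rw [Finset.card_univ, Fintype.card_fin, hthird] at h1
    rw [hthird] at h2'
    have h5 := hF kstar kstar _ h4
    have h6 := measureReal_union_le (μ := P) (⋃ k ∈ (Finset.univ : Finset (Fin K)),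
      F kstar k (δ / (3 * K))) (⋃ k ∈ Finset.univ.erase kstar, F k k (δ / (3 * K)))
    have h7 := measureReal_union_le (μ := P) ((⋃ k ∈ (Finset.univ : Finset (Fin K)),
      F kstar k (δ / (3 * K))) ∪ (⋃ k ∈ Finset.univ.erase kstar, F k k (δ / (3 * K))))
      (F kstar kstar (δ / 4))
    have h2'' : P.real (⋃ k ∈ Finset.univ.erase kstar, F k k (δ / (3 * K))) ≤ δ / 3 := h2'
    linarith
  have hsub : Gᶜ ⊆ {ω | CLUCBpp.Declares I (X · ω) (Y · ω) kstar} := by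
    intro ω hω
    simp only [G, Set.compl_union, Set.compl_iUnion, Set.mem_inter_iff, Set.mem_iInter,
      Finset.mem_univ, Finset.mem_erase, true_implies, and_true] at hω
    obtain ⟨⟨hω₁, hω₂⟩, hω₃⟩ := hω
    have hdev : ∀ {ℓ k η}, ω ∈ (F ℓ k η)ᶜ → ∀ t,
        (∀ i < t, 1 < (CLUCBpp.run I (X · ω) (Y · ω) i).active.card) →
        1 ≤ (CLUCBpp.run I (X · ω) (Y · ω) t).n k →
        |CLUCBpp.phiHat (CLUCBpp.run I (X · ω) (Y · ω) t) ℓ k - ∫ r, s ℓ k (r k) ∂ν|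
          ≤ B ((CLUCBpp.run I (X · ω) (Y · ω) t).n k) η := fun h t ht hn =>
      not_lt.1 fun hlt => h ⟨t, ht, hn, hlt⟩
    refine CLUCBpp.declares_of_accurate (φ := fun k => ∫ r, s kstar k (r k) ∂ν)
      (μ := fun k => ∫ r, r k ∂ν) hb ⟨hδ, hδ1⟩ hB_anti (hB_lim _ h3) hpick hφ hbest
      fun t ht => ⟨fun k => hdev (hω₁ k) t ht, fun k hn => ?_, fun hn => ?_⟩
    · have : ω ∈ (F k k (δ / (3 * K)))ᶜ := by
        by_cases hk : k = kstar
        · subst hk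
          exact hω₁ k
        · exact hω₂ k hk
      simpa only [hs_diag] using hdev this t ht hn
    · simpa only [hs_diag] using hdev hω₃ t ht hn
  have hone : 1 ≤ P.real G + P.real Gᶜ := by
    have := measureReal_union_le (μ := P) G Gᶜ
    rwa [Set.union_compl_self, probReal_univ] at this
  have hmono := measureReal_mono (μ := P) hsub
  linarith
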